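/- Theorem (Comparison Principle). Let $\mu,\sigma,c,a,\lambda$ be real constants with $\sigma\neq 0$, $c>0$, $\lambda>0$, $a>\max\{1,2\mu\}$ and $\mu>\max\{c,\sigma^2/2\}$. Put $$f(z)=\mu z+\lambda\ln\Big[\frac{\lambda\,(e^{\frac a\lambda(1-z)}-1)}{1-z}\Big]\ (z\neq1),\qquad f(1)=\mu+\lambda\ln a,$$ and consider the equation $$\tfrac12\sigma^2v''(x)+f(v'(x))-cv(x)=0,\quad x\ge0;\qquad v(0)=0. \qquad (*)$$ An upper (resp. lower) semicontinuous function $u:[0,\infty)\to\mathbb R$ is a viscosity subsolution (resp. supersolution) of $(*)$ if $u(0)=0$ and, for all $x>0$ and $\varphi\in C^2(\mathbb R)$ with $0=[u-\varphi](x)=\max_{y\in(0,\infty)}[u-\varphi](y)$ (resp. $\min_{y\in(0,\infty)}$), one has $\frac12\sigma^2\varphi''(x)+f(\varphi'(x))-cu(x)\ge0$ (resp. $\le0$). A viscosity solution is a continuous function on $[0,\infty)$ that is both. A function is of class $(L)$ if it is nondecreasing and bounded on $[0,\infty)$. (1) If $\bar v$ is a viscosity supersolution and $\underline v$ a viscosity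 subsolution of $(*)$, both of class $(L)$, then $\underline v\le\bar v$ on $[0,\infty)$. (2) Let $H$ be the unique real number with $f(H)=\mu H$, and let $A,M,b>0$ satisfy $M>2\mu/\sigma^2$, $$\frac1M\Big\{\ln\frac{A}{A-M}\vee\ln\frac{A}{A-\frac{f(0)}cM}\Big\}<b<\frac1M\Big\{\ln\frac AH\wedge\ln\Big(\frac{\sigma^2}{2\mu}M\Big)\Big\},$$ $$A>\max\Big\{M+H,\ \tfrac{f(0)}cM+H,\ \tfrac{\sigma^2M^2}{\sigma^2M-2\mu},\ \tfrac{f(0)}c\cdot\tfrac{\sigma^2M^2}{\sigma^2M-2\mu}\Big\}.$$ Put $\underline\psi(x)=1-e^{-x}$ and $\overline\psi(x)=\frac AM(1-e^{-M(x\wedge b)})$, let $\mathfrak F$ be the set of continuous viscosity subsolutions $u$ of $(*)$ of class $(L)$ with $\underline\psi\le u\le\overline\psi$ on $[0,\infty)$, and for $x\ge0$ let $\hat v(x)=\sup_{u\in\mathfrak F}u(x)$, $$v^*(x)=\lim_{r\downarrow0}\,\sup\{\hat v(y):y>0,\ |y-x|\le r\},\qquad v_*(x)=\lim_{r\downarrow0}\,\inf\{\hat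 v(y):y>0,\ |y-x|\le r\}.$$ Then $v^*=v_*=\hat v$ on $[0,\infty)$, and this function is the unique viscosity solution of class $(L)$ of $(*)$ on $[0,\infty)$. -/

import Mathlib

open Set Filter Topology

namespace Dividend

/-- The nonlinearity `f(z) = μ z + λ log (λ (exp (a (1 - z) / λ) - 1) / (1 - z))` for `z ≠ 1`,
and `f(1) = μ + λ log a`. -/
noncomputable def f (μ a lam z : ℝ) : ℝ :=
  if z = 1 then μ + lam * Real.log a
  else μ * z + lam * Real.log (lam * (Real.exp (a / lam * (1 - z)) - 1) / (1 - z))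

/-- Viscosity subsolutions on `[0, ∞)` of
`(σ² / 2) v'' + f(v') - c v = 0`, `v(0) = 0`.
Only the values of `u` on `[0, ∞)` matter. -/
def IsViscositySubsolution (μ σ c a lam : ℝ) (u : ℝ → ℝ) : Prop :=
  UpperSemicontinuousOn u (Ici 0) ∧ u 0 = 0 ∧
    ∀ x : ℝ, 0 < x → ∀ φ : ℝ → ℝ, ContDiff ℝ 2 φ →
      u x - φ x = 0 → IsMaxOn (fun y => u y - φ y) (Ioi 0) x →
        0 ≤ 1 / 2 * σ ^ 2 * deriv (deriv φ) x + f μ a lam (deriv φ x) - c * u x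

/-- Viscosity supersolutions on `[0, ∞)` of the same equation. -/
def IsViscositySupersolution (μ σ c a lam : ℝ) (u : ℝ → ℝ) : Prop :=
  LowerSemicontinuousOn u (Ici 0) ∧ u 0 = 0 ∧
    ∀ x : ℝ, 0 < x → ∀ φ : ℝ → ℝ, ContDiff ℝ 2 φ →
      u x - φ x = 0 → IsMinOn (fun y => u y - φ y) (Ioi 0) x →
        1 / 2 * σ ^ 2 * deriv (deriv φ) x + f μ a lam (deriv φ x) - c * u x ≤ 0

/-- Viscosity solutions on `[0, ∞)` of the same equation. -/
def IsViscositySolution (μ σ c a lam : ℝ) (u : ℝ → ℝ) : Prop :=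
  ContinuousOn u (Ici 0) ∧
    IsViscositySubsolution μ σ c a lam u ∧ IsViscositySupersolution μ σ c a lam u

/-- Class (L): nondecreasing and bounded on `[0, ∞)`
(local integrability is automatic for a monotone function). -/
def ClassL (u : ℝ → ℝ) : Prop :=
  MonotoneOn u (Ici 0) ∧ ∃ C : ℝ, ∀ x : ℝ, 0 ≤ x → |u x| ≤ C

/-- The lower barrier `1 - exp (-x)`. -/
noncomputable def psiLower (x : ℝ) : ℝ := 1 - Real.exp (-x)

/-- The upper barrier `(A / M) (1 - exp (-M (x ∧ b)))`. -/
noncomputable def psiUpper (A M b x : ℝ) : ℝ := A / M * (1 - Real.exp (-(M * min x b)))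

/-- The constraints on the constants `A, M, b` of the upper barrier; `H` is the abscissa of the
intersection point of the graph of `f` with the line `z ↦ μ z`. -/
structure BarrierConstants (μ σ c a lam H A M b : ℝ) : Prop where
  intersection : f μ a lam H = μ * H
  A_pos : 0 < A
  M_pos : 0 < M
  b_pos : 0 < b
  M_gt : 2 * μ / σ ^ 2 < M
  b_gt : 1 / M * max (Real.log (A / (A - M))) (Real.log (A / (A - f μ a lam 0 / c * M))) < b
  b_lt : b < 1 / M * min (Real.log (A / H)) (Real.log (σ ^ 2 / (2 * μ) * M))
  A_gt₁ : M + H < A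
  A_gt₂ : f μ a lam 0 / c * M + H < A
  A_gt₃ : σ ^ 2 * M ^ 2 / (σ ^ 2 * M - 2 * μ) < A
  A_gt₄ : f μ a lam 0 / c * (σ ^ 2 * M ^ 2 / (σ ^ 2 * M - 2 * μ)) < A

/-- The family of continuous class (L) viscosity subsolutions lying between the two barriers. -/
def perronFamily (μ σ c a lam A M b : ℝ) : Set (ℝ → ℝ) :=
  {u | ContinuousOn u (Ici 0) ∧ (∀ x : ℝ, 0 ≤ x → psiLower x ≤ u x ∧ u x ≤ psiUpper A M b x) ∧
    ClassL u ∧ IsViscositySubsolution μ σ c a lam u}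

/-- The pointwise supremum of the family, to be read on `[0, ∞)`. -/
noncomputable def perronSup (μ σ c a lam A M b : ℝ) (x : ℝ) : ℝ :=
  sSup ((fun u : ℝ → ℝ => u x) '' perronFamily μ σ c a lam A M b)

/-- The upper semicontinuous envelope `x ↦ lim_{r ↓ 0} sup {v y : y > 0, |y - x| ≤ r}`. -/
noncomputable def uscEnvelope (v : ℝ → ℝ) (x : ℝ) : ℝ := limsup v (𝓝[Ioi 0] x)

/-- The lower semicontinuous envelope `x ↦ lim_{r ↓ 0} inf {v y : y > 0, |y - x| ≤ r}`. -/
noncomputable def lscEnvelope (v : ℝ → ℝ) (x : ℝ) : ℝ := liminf v (𝓝[Ioi 0] x)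

end Dividend

/-! The equation has a bounded nondecreasing classical solution `V` with `V 0 = 0`
(`exists_isClassicalSolution`). Once `V` is available, no doubling of variables and no Perron
construction is needed. A bounded subsolution lies below `V` and a bounded supersolution above it,
because `V` plus a small quadratic is itself an admissible test function
(`le_of_viscosity_subsolution`). Chaining the two inequalities gives the comparison principle and
uniqueness. Applied to the barriers, they put `V` in the Perron family, and applied to the members
of the family, they make `V` its largest element. So the supremum is `V`, and by continuity so are
both envelopes.

`V` comes from shooting (`ShootingData.exists_bounded_trajectory`). In the planar system for `(v,
v')`, initial slopes whose `v'` turns negative and initial slopes whose `v` passes `f 0 / c` while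
still increasing form disjoint nonempty open sets. Connectedness of the line leaves a slope in
neither set, and its trajectory is bounded and monotone. All that is needed of `f` is that its
difference quotients lie in `[μ - a, μ]` and that `f > μ` on `(-∞, 1]`. -/

namespace Dividend

/-! ### The nonlinearity -/

/-- The integral `∫₀ᵃ exp (u (1 - z) / λ) du`, whose logarithm enters the nonlinearity. -/
noncomputable def expIntegral (a lam z : ℝ) : ℝ :=
  ∫ u in (0 : ℝ)..a, Real.exp (u * ((1 - z) / lam))

lemma expIntegral_eq {a lam z : ℝ} (hlam : 0 < lam) (hz : z ≠ 1) :
    expIntegral a lam z = lam * (Real.exp (a / lam * (1 - z)) - 1) / (1 - z) := by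
  have hz' : 1 - z ≠ 0 := sub_ne_zero.2 (Ne.symm hz)
  have h : (1 - z) / lam ≠ 0 := div_ne_zero hz' hlam.ne'
  rw [expIntegral, intervalIntegral.integral_comp_mul_right _ h, integral_exp]
  simp only [smul_eq_mul, zero_mul, Real.exp_zero]
  rw [show a * ((1 - z) / lam) = a / lam * (1 - z) by ring]
  field_simp

lemma f_eq_log_expIntegral (μ : ℝ) {a lam : ℝ} (hlam : 0 < lam) (z : ℝ) :
    f μ a lam z = μ * z + lam * Real.log (expIntegral a lam z) := by
  unfold f
  split_ifs with h
  · simp [expIntegral, h]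
  · rw [expIntegral_eq hlam h]

lemma continuous_exp_mul (s : ℝ) : Continuous fun u : ℝ => Real.exp (u * s) := by fun_prop

lemma expIntegral_pos {a : ℝ} (ha : 0 < a) (lam z : ℝ) : 0 < expIntegral a lam z :=
  intervalIntegral.intervalIntegral_pos_of_pos_on
    ((continuous_exp_mul _).intervalIntegrable _ _) (fun _ _ => Real.exp_pos _) ha

lemma expIntegral_antitone {a lam : ℝ} (ha : 0 < a) (hlam : 0 < lam) :
    Antitone (expIntegral a lam) := by
  intro z w h
  refine intervalIntegral.integral_mono_on ha.le ((continuous_exp_mul _).intervalIntegrable _ _)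
    ((continuous_exp_mul _).intervalIntegrable _ _) fun u hu => Real.exp_le_exp.2 ?_
  exact mul_le_mul_of_nonneg_left (div_le_div_of_nonneg_right (by linarith) hlam.le) hu.1

/-- The exponents of the two integrands differ by `u * (w - z) / lam`, which is largest at `u = a`.
-/
lemma expIntegral_le_exp_mul {a lam z w : ℝ} (ha : 0 < a) (hlam : 0 < lam) (h : z ≤ w) :
    expIntegral a lam z ≤ Real.exp (a * (w - z) / lam) * expIntegral a lam w := by
  unfold expIntegral
  rw [← intervalIntegral.integral_const_mul]
  refine intervalIntegral.integral_mono_on ha.le ((continuous_exp_mul _).intervalIntegrable _ _)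
    (((continuous_exp_mul _).intervalIntegrable _ _).const_mul _) fun u hu => ?_
  rw [← Real.exp_add]
  refine Real.exp_le_exp.2 ?_
  have : u * (w - z) ≤ a * (w - z) := mul_le_mul_of_nonneg_right hu.2 (by linarith)
  have h2 : u * ((1 - z) / lam) = u * (w - z) / lam + u * ((1 - w) / lam) := by field_simp; ring
  rw [h2]
  exact add_le_add_left (div_le_div_of_nonneg_right this hlam.le) _

/-- `f z - μ * z` is `lam` times the logarithm of an integral that decreases in `z`. -/
lemma f_sub_le (μ : ℝ) {a lam z w : ℝ} (ha : 0 < a) (hlam : 0 < lam) (h : z ≤ w) :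
    f μ a lam w - f μ a lam z ≤ μ * (w - z) := by
  rw [f_eq_log_expIntegral μ hlam, f_eq_log_expIntegral μ hlam]
  have := mul_le_mul_of_nonneg_left
    (Real.log_le_log (expIntegral_pos ha lam w) (expIntegral_antitone ha hlam h)) hlam.le
  linarith

lemma le_f_sub (μ : ℝ) {a lam z w : ℝ} (ha : 0 < a) (hlam : 0 < lam) (h : z ≤ w) :
    (μ - a) * (w - z) ≤ f μ a lam w - f μ a lam z := by
  rw [f_eq_log_expIntegral μ hlam, f_eq_log_expIntegral μ hlam]
  have h1 := Real.log_le_log (expIntegral_pos ha lam z) (expIntegral_le_exp_mul ha hlam h)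
  rw [Real.log_mul (Real.exp_pos _).ne' (expIntegral_pos ha lam w).ne', Real.log_exp] at h1
  have h2 := mul_le_mul_of_nonneg_left h1 hlam.le
  have h3 : lam * (a * (w - z) / lam) = a * (w - z) := by field_simp
  rw [mul_add, h3] at h2
  linarith

lemma abs_f_sub_le {μ a lam : ℝ} (hμ : 0 < μ) (ha : μ ≤ a) (hlam : 0 < lam) (z w : ℝ) :
    |f μ a lam z - f μ a lam w| ≤ a * |z - w| := by
  wlog h : w ≤ z generalizing z w
  · rw [abs_sub_comm, abs_sub_comm z]
    exact this w z (not_le.1 h).le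
  have h1 := f_sub_le μ (hμ.trans_le ha) hlam h
  have h2 := le_f_sub μ (hμ.trans_le ha) hlam h
  rw [abs_of_nonneg (sub_nonneg.2 h), abs_le]
  constructor <;> nlinarith

lemma f_le_add_mul (μ : ℝ) {a lam z : ℝ} (ha : 0 < a) (hlam : 0 < lam) (hz : 0 ≤ z) :
    f μ a lam z ≤ f μ a lam 0 + μ * z := by
  have := f_sub_le μ ha hlam hz
  rw [sub_zero] at this
  linarith

lemma f_le_mul_of_le {μ a lam H z : ℝ} (ha : 0 < a) (hlam : 0 < lam)
    (hH : f μ a lam H = μ * H) (hz : H ≤ z) : f μ a lam z ≤ μ * z := by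
  have := f_sub_le μ ha hlam hz
  linarith

/-- Jensen's inequality: the exponential lies above its tangent at the midpoint `a / 2`, and the
linear part of the tangent integrates to zero over `[0, a]`. -/
lemma mul_exp_le_expIntegral {a lam z : ℝ} (ha : 0 < a) :
    a * Real.exp (a / 2 * ((1 - z) / lam)) ≤ expIntegral a lam z := by
  set s := (1 - z) / lam with hs
  have key : ∫ u in (0 : ℝ)..a, Real.exp (a / 2 * s) * (1 + s * (u - a / 2)) =
      a * Real.exp (a / 2 * s) := by
    have hd : ∀ u ∈ uIcc 0 a, HasDerivAt
        (fun u : ℝ => Real.exp (a / 2 * s) * (u + s * (u ^ 2 / 2 - a / 2 * u)))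
        (Real.exp (a / 2 * s) * (1 + s * (u - a / 2))) u := by
      intro u _
      have := (((hasDerivAt_id u).add (((((hasDerivAt_id u).pow 2).div_const 2).sub
        ((hasDerivAt_id u).const_mul (a / 2))).const_mul s)).const_mul (Real.exp (a / 2 * s)))
      refine this.congr_deriv ?_
      simp
    rw [intervalIntegral.integral_eq_sub_of_hasDerivAt hd
      (Continuous.intervalIntegrable (by fun_prop) _ _)]
    ring
  rw [← key]
  refine intervalIntegral.integral_mono_on ha.le (Continuous.intervalIntegrable (by fun_prop) _ _)
    ((continuous_exp_mul _).intervalIntegrable _ _) fun u _ => ?_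
  have h1 : Real.exp (u * s) = Real.exp (a / 2 * s) * Real.exp (s * (u - a / 2)) := by
    rw [← Real.exp_add]; ring_nf
  rw [h1]
  refine mul_le_mul_of_nonneg_left ?_ (Real.exp_pos _).le
  linarith [Real.add_one_le_exp (s * (u - a / 2))]

lemma add_mul_le_f (μ : ℝ) {a lam : ℝ} (ha : 0 < a) (hlam : 0 < lam) (z : ℝ) :
    μ * z + lam * Real.log a + a / 2 * (1 - z) ≤ f μ a lam z := by
  rw [f_eq_log_expIntegral μ hlam]
  have h := Real.log_le_log (mul_pos ha (Real.exp_pos _)) (mul_exp_le_expIntegral (lam := lam)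
    (z := z) ha)
  rw [Real.log_mul ha.ne' (Real.exp_pos _).ne', Real.log_exp] at h
  have h2 := mul_le_mul_of_nonneg_left h hlam.le
  have h3 : lam * (a / 2 * ((1 - z) / lam)) = a / 2 * (1 - z) := by field_simp
  rw [mul_add, h3] at h2
  linarith

/-- The linear lower bound equals `μ + lam * log a + (a / 2 - μ) * (1 - z)`; here `a > 1` makes the
logarithm positive and `a > 2 * μ` handles the last term. -/
lemma lt_f {μ a lam z : ℝ} (ha : max 1 (2 * μ) < a) (hlam : 0 < lam) (hz : z ≤ 1) :
    μ < f μ a lam z := by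
  have ha1 : 1 < a := (le_max_left _ _).trans_lt ha
  have ha2 : 2 * μ < a := (le_max_right _ _).trans_lt ha
  have h := add_mul_le_f μ (zero_lt_one.trans ha1) hlam z
  have h2 := mul_pos hlam (Real.log_pos ha1)
  nlinarith

/-! ### The maximum principle -/

/-- A positive second derivative would make `x` a local minimum as well, so `h` would be locally
constant. -/
lemma deriv_deriv_nonpos_of_isLocalMax {h : ℝ → ℝ} {x : ℝ} (hx : IsLocalMax h x)
    (hc : ContinuousAt h x) : deriv (deriv h) x ≤ 0 := by
  by_contra! hpos
  have hmin := isLocalMin_of_deriv_deriv_pos hpos hx.deriv_eq_zero hc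
  have hconst : h =ᶠ[𝓝 x] fun _ => h x := by
    filter_upwards [hx, hmin] with y h1 h2 using le_antisymm h1 h2
  have h1 : deriv h =ᶠ[𝓝 x] fun _ => 0 := by simpa using hconst.deriv
  have h2 := h1.deriv_eq
  simp only [deriv_const] at h2
  exact hpos.ne' h2

lemma deriv_eq_and_le_of_isLocalMax_sub {V φ : ℝ → ℝ} (hV : ContDiff ℝ 2 V) (hφ : ContDiff ℝ 2 φ)
    {x : ℝ} (hx : IsLocalMax (fun y => V y - φ y) x) :
    deriv V x = deriv φ x ∧ deriv (deriv V) x ≤ deriv (deriv φ) x := by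
  have hVd := hV.differentiable two_ne_zero
  have hφd := hφ.differentiable two_ne_zero
  have hV1 : Differentiable ℝ (deriv V) := hV.differentiable_deriv_two
  have hφ1 : Differentiable ℝ (deriv φ) := hφ.differentiable_deriv_two
  have h1 : deriv (fun y => V y - φ y) = fun y => deriv V y - deriv φ y := by
    funext y
    exact deriv_fun_sub (hVd y) (hφd y)
  have h2 := hx.deriv_eq_zero
  have h3 := deriv_deriv_nonpos_of_isLocalMax hx (hVd.sub hφd).continuous.continuousAt
  rw [h1] at h2 h3
  rw [deriv_fun_sub (hV1 x) (hφ1 x)] at h3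
  exact ⟨sub_eq_zero.1 h2, sub_nonpos.1 h3⟩

/-- A bounded viscosity subsolution of `s v'' + g(v') - c v = 0` lies below every `C²`
supersolution which is bounded below and dominates it at the origin. -/
theorem le_of_viscosity_subsolution {g : ℝ → ℝ} {L s c : ℝ} (hs : 0 ≤ s) (hc : 0 < c)
    (hg : ∀ p q, |g p - g q| ≤ L * |p - q|) {u V : ℝ → ℝ}
    (husc : UpperSemicontinuousOn u (Ici 0)) {C : ℝ} (hC : ∀ x, 0 ≤ x → u x - V x ≤ C)
    (h0 : u 0 ≤ V 0)
    (hsub : ∀ x : ℝ, 0 < x → ∀ φ : ℝ → ℝ, ContDiff ℝ 2 φ →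
      u x - φ x = 0 → IsMaxOn (fun y => u y - φ y) (Ioi 0) x →
        0 ≤ s * deriv (deriv φ) x + g (deriv φ x) - c * u x)
    (hV : ContDiff ℝ 2 V)
    (hsup : ∀ x : ℝ, 0 < x → s * deriv (deriv V) x + g (deriv V x) - c * V x ≤ 0)
    {x : ℝ} (hx : 0 ≤ x) : u x ≤ V x := by
  by_contra! hlt
  have hx0 : 0 < x := hx.lt_of_ne fun h => by rw [← h] at hlt; exact hlt.not_ge h0
  set δ := u x - V x with hδ
  have hδ0 : 0 < δ := sub_pos.2 hlt
  -- At a maximum `z` of `u - V - ε y²`, the two inequalities give `c (u z - V z) ≤ ε (2 s + 2 L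
  -- z)`. Since `2 L z ≤ L² / c + c z²` and `u z - V z ≥ δ - ε x² + ε z²`, the terms in `z²` cancel
  -- and `c δ ≤ ε D` remains. The choice of `ε` makes the right side `c δ / 2`.
  set D := 2 * s + L ^ 2 / c + c * x ^ 2 with hD
  have hD0 : 0 < D := by positivity
  set ε := c * δ / (2 * D) with hε
  have hε0 : 0 < ε := by positivity
  have hεD : ε * D = c * δ / 2 := by rw [hε]; field_simp
  have hεx : ε * x ^ 2 ≤ δ / 2 := by
    have h1 : ε * (c * x ^ 2) ≤ ε * D :=
      mul_le_mul_of_nonneg_left (by rw [hD]; linarith [show 0 ≤ L ^ 2 / c by positivity]) hε0.le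
    rw [hεD] at h1
    refine le_of_mul_le_mul_left ?_ hc
    linarith
  set Φ : ℝ → ℝ := fun y => u y + -(V y + ε * y ^ 2) with hΦ
  have hVc : Continuous V := hV.continuous
  -- Beyond `R` the penalty exceeds the bound `C`; the summand `1` ensures `R ≤ R²`.
  set R := x + 1 + |C| / ε with hR
  have hR1 : x + 1 ≤ R := by rw [hR]; linarith [show 0 ≤ |C| / ε by positivity]
  have hRC : |C| ≤ ε * R ^ 2 := by
    have h1 : |C| = ε * (|C| / ε) := by field_simp
    have h2 : |C| / ε ≤ R := by rw [hR]; linarith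
    have h3 : R ≤ R ^ 2 := by nlinarith
    rw [h1]
    exact mul_le_mul_of_nonneg_left (h2.trans h3) hε0.le
  have hΦx : δ / 2 ≤ Φ x := by simp only [hΦ]; linarith
  obtain ⟨z, hz, hmax⟩ := UpperSemicontinuousOn.exists_isMaxOn (f := Φ) (s := Icc 0 R)
    ⟨x, hx, by linarith⟩ isCompact_Icc
    ((husc.mono Icc_subset_Ici_self).add
      (Continuous.upperSemicontinuous (by fun_prop) |>.upperSemicontinuousOn _))
  have hzx : Φ x ≤ Φ z := hmax ⟨hx, by linarith⟩
  have hmax' : ∀ y, 0 ≤ y → Φ y ≤ Φ z := by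
    intro y hy
    rcases le_or_gt y R with h | h
    · exact hmax ⟨hy, h⟩
    · have h1 : R ^ 2 ≤ y ^ 2 := by nlinarith
      have h2 := mul_le_mul_of_nonneg_left h1 hε0.le
      have h3 := hC y hy
      have h4 := le_abs_self C
      simp only [hΦ] at hzx hΦx ⊢
      linarith
  have hz0 : 0 < z := by
    refine hz.1.lt_of_ne fun h => ?_
    have h1 : δ / 2 ≤ Φ z := hΦx.trans hzx
    rw [← h] at h1
    simp only [hΦ] at h1
    norm_num at h1
    linarith
  have hVd := hV.differentiable two_ne_zero
  have hV1 : Differentiable ℝ (deriv V) := hV.differentiable_deriv_two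
  set φ : ℝ → ℝ := fun y => V y + ε * y ^ 2 + Φ z with hφ
  have hφ1 : deriv φ = fun y => deriv V y + ε * (2 * y) := by
    funext y
    have := (((hVd y).hasDerivAt.add (((hasDerivAt_id y).pow 2).const_mul ε)).add_const (Φ z))
    refine (this.congr_deriv ?_ : HasDerivAt φ _ y).deriv
    simp
  have hφ2 : deriv (deriv φ) z = deriv (deriv V) z + ε * 2 := by
    rw [hφ1]
    have := (hV1 z).hasDerivAt.add (((hasDerivAt_id z).const_mul 2).const_mul ε)
    refine (this.congr_deriv ?_ : HasDerivAt (fun y => deriv V y + ε * (2 * y)) _ z).deriv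
    simp
  have hineq := hsub z hz0 φ (by simp only [hφ]; fun_prop) (by simp only [hφ, hΦ]; ring) (by
    intro y hy
    have := hmax' y (le_of_lt hy)
    simp only [hΦ, hφ, mem_ofPred_eq] at this ⊢
    linarith)
  rw [hφ2, hφ1] at hineq
  have hsupz := hsup z hz0
  have hgz := (abs_le.1 (hg (deriv V z + ε * (2 * z)) (deriv V z))).2
  rw [add_sub_cancel_left, abs_of_nonneg (by positivity)] at hgz
  have hLz : L * (ε * (2 * z)) ≤ ε * (L ^ 2 / c + c * z ^ 2) := by
    have h1 : 2 * L * z ≤ L ^ 2 / c + c * z ^ 2 := by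
      have h2 : L ^ 2 / c + c * z ^ 2 - 2 * L * z = (L - c * z) ^ 2 / c := by field_simp; ring
      have h3 : 0 ≤ (L - c * z) ^ 2 / c := by positivity
      linarith
    calc L * (ε * (2 * z)) = ε * (2 * L * z) := by ring
      _ ≤ _ := mul_le_mul_of_nonneg_left h1 hε0.le
  have hu : c * (δ - ε * x ^ 2 + ε * z ^ 2) ≤ c * (u z - V z) := by
    refine mul_le_mul_of_nonneg_left ?_ hc.le
    simp only [hΦ] at hzx
    linarith
  have hcδ := mul_pos hc hδ0
  rw [hD] at hεD
  linarith

/-! ### Viscosity properties of smooth functions -/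

section Smooth

variable {μ σ c a lam : ℝ} {u V : ℝ → ℝ}

lemma isViscositySubsolution_of_contDiff (hV : ContDiff ℝ 2 V) (huV : EqOn u V (Ici 0))
    (h0 : V 0 = 0)
    (h : ∀ x, 0 < x → 0 ≤ 1 / 2 * σ ^ 2 * deriv (deriv V) x + f μ a lam (deriv V x) - c * V x) :
    IsViscositySubsolution μ σ c a lam u := by
  refine ⟨(hV.continuous.continuousOn.congr huV).upperSemicontinuousOn,
    (huV self_mem_Ici).trans h0, fun x hx φ hφ _ hmax => ?_⟩
  have hloc : IsLocalMax (fun y => V y - φ y) x := by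
    filter_upwards [Ioi_mem_nhds hx] with y hy
    have := hmax hy
    simp only [mem_ofPred_eq] at this
    rwa [huV hx.le, huV (Ioi_subset_Ici_self hy)] at this
  obtain ⟨h1, h2⟩ := deriv_eq_and_le_of_isLocalMax_sub hV hφ hloc
  have h3 := h x hx
  have h4 := mul_le_mul_of_nonneg_left h2 (show 0 ≤ 1 / 2 * σ ^ 2 by positivity)
  rw [h1] at h3
  rw [huV hx.le]
  linarith

lemma isViscositySupersolution_of_contDiff (hV : ContDiff ℝ 2 V) (huV : EqOn u V (Ici 0))
    (h0 : V 0 = 0)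
    (h : ∀ x, 0 < x → 1 / 2 * σ ^ 2 * deriv (deriv V) x + f μ a lam (deriv V x) - c * V x ≤ 0) :
    IsViscositySupersolution μ σ c a lam u := by
  refine ⟨(hV.continuous.continuousOn.congr huV).lowerSemicontinuousOn,
    (huV self_mem_Ici).trans h0, fun x hx φ hφ _ hmin => ?_⟩
  have hloc : IsLocalMax (fun y => φ y - V y) x := by
    filter_upwards [Ioi_mem_nhds hx] with y hy
    have := hmin hy
    simp only [mem_ofPred_eq] at this
    rw [huV hx.le, huV (Ioi_subset_Ici_self hy)] at this
    linarith
  obtain ⟨h1, h2⟩ := deriv_eq_and_le_of_isLocalMax_sub hφ hV hloc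
  have h3 := h x hx
  have h4 := mul_le_mul_of_nonneg_left h2 (show 0 ≤ 1 / 2 * σ ^ 2 by positivity)
  rw [← h1] at h3
  rw [huV hx.le]
  linarith

lemma IsViscositySubsolution.le_of_contDiff (hμ : 0 < μ) (ha : μ ≤ a) (hlam : 0 < lam)
    (hc : 0 < c) (hu : IsViscositySubsolution μ σ c a lam u) {C : ℝ}
    (hC : ∀ x, 0 ≤ x → u x - V x ≤ C) (hV : ContDiff ℝ 2 V) (h0 : V 0 = 0)
    (h : ∀ x, 0 < x → 1 / 2 * σ ^ 2 * deriv (deriv V) x + f μ a lam (deriv V x) - c * V x ≤ 0)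
    {x : ℝ} (hx : 0 ≤ x) : u x ≤ V x :=
  le_of_viscosity_subsolution (by positivity) hc (abs_f_sub_le hμ ha hlam)
    hu.1 hC (by rw [hu.2.1, h0]) hu.2.2 hV h hx

/-- Changing sign turns `u` into a subsolution for the nonlinearity `p ↦ -f (-p)`, which has the
same Lipschitz constant. -/
lemma IsViscositySupersolution.ge_of_contDiff (hμ : 0 < μ) (ha : μ ≤ a) (hlam : 0 < lam)
    (hc : 0 < c) (hu : IsViscositySupersolution μ σ c a lam u) {C : ℝ}
    (hC : ∀ x, 0 ≤ x → V x - u x ≤ C) (hV : ContDiff ℝ 2 V) (h0 : V 0 = 0)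
    (h : ∀ x, 0 < x → 0 ≤ 1 / 2 * σ ^ 2 * deriv (deriv V) x + f μ a lam (deriv V x) - c * V x)
    {x : ℝ} (hx : 0 ≤ x) : V x ≤ u x := by
  have hneg : ∀ φ : ℝ → ℝ, deriv (fun y => -φ y) = fun y => -deriv φ y := fun φ => by
    funext y; simp
  have := le_of_viscosity_subsolution (g := fun p => -f μ a lam (-p)) (L := a)
    (s := 1 / 2 * σ ^ 2) (u := fun y => -u y) (V := fun y => -V y) (C := C) (x := x)
    (by positivity) hc (fun p q => by
      have := abs_f_sub_le hμ ha hlam (-q) (-p)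
      rwa [show -q - -p = p - q by ring, show f μ a lam (-q) - f μ a lam (-p) =
        -f μ a lam (-p) - -f μ a lam (-q) by ring] at this)
    (fun y hy b hb => by
      filter_upwards [hu.1 y hy (-b) (by simpa using neg_lt_neg hb)] with t ht
      simpa using neg_lt_neg ht)
    (fun y hy => by linarith [hC y hy]) (by simp [hu.2.1, h0])
    (fun y hy φ hφ hy0 hmax => by
      have := hu.2.2 y hy (fun t => -φ t) hφ.neg (by linarith) (fun t ht => by
        have := hmax ht
        simp only [mem_ofPred_eq] at this ⊢
        linarith)
      simp only [hneg] at this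
      linarith) hV.neg
    (fun y hy => by
      have := h y hy
      simp only [hneg, neg_neg]
      linarith) hx
  linarith

end Smooth

/-! ### The barriers -/

lemma hasDerivAt_exp_neg_mul (k x : ℝ) :
    HasDerivAt (fun y => Real.exp (-(k * y))) (-k * Real.exp (-(k * x))) x := by
  have := ((hasDerivAt_id x).const_mul k).neg.exp
  simpa [mul_comm] using this

lemma contDiff_psiLower : ContDiff ℝ 2 psiLower := by unfold psiLower; fun_prop

lemma deriv_psiLower : deriv psiLower = fun x => Real.exp (-x) := by
  funext x
  have := (hasDerivAt_exp_neg_mul 1 x).const_sub 1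
  simp only [one_mul, neg_mul, neg_neg] at this
  exact this.deriv

lemma deriv_deriv_psiLower : deriv (deriv psiLower) = fun x => -Real.exp (-x) := by
  rw [deriv_psiLower]
  funext x
  have := hasDerivAt_exp_neg_mul 1 x
  simp only [one_mul, neg_mul] at this
  exact this.deriv

/-- With `p = exp (-x) ≤ 1`, the terms other than `f p` sum to minus a convex combination of `σ² /
2` and `c`, both below `μ`, whereas `f p > μ`. -/
lemma psiLower_classical_subsolution {μ σ c a lam : ℝ} (hlam : 0 < lam) (ha : max 1 (2 * μ) < a)
    (hμ : max c (σ ^ 2 / 2) < μ) {x : ℝ} (hx : 0 ≤ x) :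
    0 ≤ 1 / 2 * σ ^ 2 * deriv (deriv psiLower) x + f μ a lam (deriv psiLower x) -
      c * psiLower x := by
  rw [deriv_deriv_psiLower, deriv_psiLower, psiLower]
  have h1 : Real.exp (-x) ≤ 1 := Real.exp_le_one_iff.2 (by linarith)
  have h2 := lt_f ha hlam h1
  have h3 := Real.exp_pos (-x)
  have h4 := (le_max_left _ _).trans_lt hμ
  have h5 := (le_max_right _ _).trans_lt hμ
  simp only
  nlinarith

section UpperBarrier

variable {μ σ c a lam H A M b : ℝ}

lemma psiUpper_nonneg (hA : 0 < A) (hM : 0 < M) (hb : 0 < b) {x : ℝ} (hx : 0 ≤ x) :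
    0 ≤ psiUpper A M b x := by
  have h : Real.exp (-(M * min x b)) ≤ 1 :=
    Real.exp_le_one_iff.2 (neg_nonpos.2 (mul_nonneg hM.le (le_min hx hb.le)))
  exact mul_nonneg (div_pos hA hM).le (by linarith)

lemma psiUpper_le (hA : 0 < A) (hM : 0 < M) (x : ℝ) : psiUpper A M b x ≤ A / M := by
  have h := Real.exp_pos (-(M * min x b))
  exact mul_le_of_le_one_right (div_pos hA hM).le (by linarith)

lemma continuous_psiUpper : Continuous (psiUpper A M b) := by unfold psiUpper; fun_prop

lemma intersection_pos (hlam : 0 < lam) (ha : max 1 (2 * μ) < a) (hμ : 0 < μ)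
    (hH : f μ a lam H = μ * H) : 0 < H := by
  by_contra! h
  have h1 := f_le_mul_of_le (zero_lt_one.trans ((le_max_left _ _).trans_lt ha)) hlam hH h
  have h2 := lt_f ha hlam zero_le_one
  linarith

/-- On the exponential branch the slope `p` is at least `H`, so `f p ≤ μ p`, and the curvature `-M
p` outweighs this because `σ² M > 2 μ`. On the plateau the value exceeds `f 0 / c`. -/
lemma psiUpper_isViscositySupersolution (hσ : σ ≠ 0) (hc : 0 < c) (hlam : 0 < lam)
    (ha : max 1 (2 * μ) < a) (hμ : 0 < μ) (h : BarrierConstants μ σ c a lam H A M b) :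
    IsViscositySupersolution μ σ c a lam (psiUpper A M b) := by
  have hA := h.A_pos
  have hM := h.M_pos
  have hb := h.b_pos
  have hσ2 : 0 < σ ^ 2 := by positivity
  have hH := intersection_pos hlam ha hμ h.intersection
  have hMσ : 2 * μ < σ ^ 2 * M := by
    have := (div_lt_iff₀ hσ2).1 h.M_gt
    linarith
  have hbH : H < A * Real.exp (-(M * b)) := by
    have h1 : M * b < Real.log (A / H) := by
      have h2 := mul_lt_mul_of_pos_left h.b_lt hM
      rw [← mul_assoc, mul_one_div_cancel hM.ne', one_mul] at h2
      exact h2.trans_le (min_le_left _ _)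
    rw [Real.lt_log_iff_exp_lt (by positivity), lt_div_iff₀ hH] at h1
    rw [Real.exp_neg, ← div_eq_mul_inv, lt_div_iff₀ (Real.exp_pos _)]
    linarith
  have hbf : f μ a lam 0 / c < A / M * (1 - Real.exp (-(M * b))) := by
    set k := f μ a lam 0 / c with hk
    have hAk : 0 < A - k * M := by linarith [h.A_gt₂]
    have h1 : Real.log (A / (A - k * M)) < M * b := by
      have h2 := mul_lt_mul_of_pos_left h.b_gt hM
      rw [← mul_assoc, mul_one_div_cancel hM.ne', one_mul] at h2
      exact (le_max_right _ _).trans_lt h2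
    rw [Real.log_lt_iff_lt_exp (by positivity), div_lt_iff₀ hAk] at h1
    have h3 : A * Real.exp (-(M * b)) < A - k * M := by
      rw [Real.exp_neg, ← div_eq_mul_inv, div_lt_iff₀ (Real.exp_pos _)]
      linarith
    rw [div_mul_eq_mul_div, lt_div_iff₀ hM]
    linarith
  refine ⟨continuous_psiUpper.lowerSemicontinuous.lowerSemicontinuousOn _, ?_, ?_⟩
  · simp [psiUpper, min_eq_left hb.le]
  intro x hx φ hφ _ hmin
  -- The kink `x = b` belongs to the first case: the barrier lies below the full exponential `E` and
  -- equals it at `b`, so a function touching the barrier from below also touches `E`.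
  rcases le_or_gt x b with hxb | hxb
  · set E : ℝ → ℝ := fun y => A / M * (1 - Real.exp (-(M * y))) with hE
    have hE1 : deriv E = fun y => A * Real.exp (-(M * y)) := by
      funext y
      rw [(((hasDerivAt_exp_neg_mul M y).const_sub 1).const_mul (A / M)).deriv]
      field_simp
    have hE2 : deriv (deriv E) x = -(M * (A * Real.exp (-(M * x)))) := by
      rw [hE1, ((hasDerivAt_exp_neg_mul M x).const_mul A).deriv]
      ring
    have hψE : ∀ y, psiUpper A M b y ≤ E y := by
      intro y
      simp only [hE, psiUpper]
      gcongr
      exact min_le_left _ _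
    have hψx : psiUpper A M b x = E x := by simp only [hE, psiUpper, min_eq_left hxb]
    have hloc : IsLocalMax (fun y => φ y - E y) x := by
      filter_upwards [Ioi_mem_nhds hx] with y hy
      have h1 := hmin hy
      simp only [mem_ofPred_eq] at h1
      linarith [hψE y]
    obtain ⟨h1, h2⟩ := deriv_eq_and_le_of_isLocalMax_sub hφ (by simp only [hE]; fun_prop) hloc
    rw [hE1] at h1
    rw [hE2] at h2
    simp only at h1
    set p := A * Real.exp (-(M * x)) with hp
    have hpH : H ≤ p := by
      refine hbH.le.trans ?_
      rw [hp]
      gcongr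
    have h3 := f_le_mul_of_le (zero_lt_one.trans ((le_max_left _ _).trans_lt ha)) hlam
      h.intersection hpH
    have h4 := mul_nonneg hc.le (psiUpper_nonneg hA hM hb hx.le)
    have h5 := mul_le_mul_of_nonneg_left h2 (show 0 ≤ 1 / 2 * σ ^ 2 by positivity)
    have h6 : 2 * μ * p ≤ σ ^ 2 * M * p :=
      mul_le_mul_of_nonneg_right hMσ.le (hH.le.trans hpH)
    rw [h1]
    linarith
  · have hψx : ∀ y, b < y → psiUpper A M b y = A / M * (1 - Real.exp (-(M * b))) :=
      fun y hy => by rw [psiUpper, min_eq_right hy.le]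
    have hloc : IsLocalMax (fun y => φ y - (fun _ => psiUpper A M b x) y) x := by
      filter_upwards [Ioi_mem_nhds hxb] with y hy
      have h1 := hmin (show y ∈ Ioi 0 from hb.trans hy)
      simp only [mem_ofPred_eq] at h1
      rw [hψx y hy, ← hψx x hxb] at h1
      linarith
    obtain ⟨h1, h2⟩ := deriv_eq_and_le_of_isLocalMax_sub hφ contDiff_const hloc
    simp only [deriv_const'] at h1 h2
    have h5 := mul_le_mul_of_nonneg_left h2 (show 0 ≤ 1 / 2 * σ ^ 2 by positivity)
    have h6 := (div_lt_iff₀ hc).1 hbf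
    rw [h1, hψx x hxb]
    linarith

end UpperBarrier

/-! ### Global trajectories of bounded Lipschitz vector fields -/

open scoped NNReal in
theorem exists_global_trajectory {E : Type*} [NormedAddCommGroup E] [NormedSpace ℝ E]
    [CompleteSpace E] {F : E → E} {K B : ℝ≥0} (hF : LipschitzWith K F) (hB : ∀ x, ‖F x‖ ≤ B)
    (x₀ : E) : ∃ α : ℝ → E, α 0 = x₀ ∧ ∀ t, HasDerivAt α (F (α t)) t := by
  have hloc : ∀ T : ℝ, ∃ γ : ℝ → E, 0 < T → γ 0 = x₀ ∧
      ∀ t ∈ Ioo (-T) T, HasDerivAt γ (F (γ t)) t := by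
    intro T
    by_cases hT : 0 < T
    -- The bound `B` on the field confines solutions to a ball of radius `B * T`, so the Picard
    -- interval can be as long as desired.
    · have hPL : IsPicardLindelof (fun _ => F) (tmin := -T) (tmax := T)
          ⟨0, by constructor <;> linarith⟩ x₀ (B * T.toNNReal) 0 B K :=
        { lipschitzOnWith := fun _ _ => hF.lipschitzOnWith
          continuousOn := fun _ _ => continuousOn_const
          norm_le := fun _ _ x _ => hB x
          mul_max_le := by simp [hT.le] }
      obtain ⟨γ, h0, h⟩ := hPL.exists_eq_forall_mem_Icc_hasDerivWithinAt₀
      exact ⟨γ, fun _ => ⟨h0, fun t ht =>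
        (h t (Ioo_subset_Icc_self ht)).hasDerivAt (Icc_mem_nhds ht.1 ht.2)⟩⟩
    · exact ⟨fun _ => 0, fun h => absurd h hT⟩
  choose γ hγ using hloc
  have hagree : ∀ T S : ℝ, 0 < T → T ≤ S → EqOn (γ T) (γ S) (Ioo (-T) T) := fun T S hT hTS =>
    ODE_solution_unique_of_mem_Ioo (v := fun _ => F) (s := fun _ => univ) (K := K) (t₀ := 0)
      (fun _ _ => hF.lipschitzOnWith) ⟨by linarith, hT⟩
      (fun t ht => ⟨(hγ T hT).2 t ht, mem_univ _⟩)
      (fun t ht => ⟨(hγ S (hT.trans_le hTS)).2 t ⟨by linarith [ht.1], by linarith [ht.2]⟩,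
        mem_univ _⟩)
      (by rw [(hγ T hT).1, (hγ S (hT.trans_le hTS)).1])
  have hpos : ∀ t : ℝ, 0 < |t| + 1 := fun t => by positivity
  have hmem : ∀ t : ℝ, t ∈ Ioo (-(|t| + 1)) (|t| + 1) := fun t =>
    abs_lt.1 (lt_add_one |t|)
  refine ⟨fun t => γ (|t| + 1) t, by simpa using (hγ (|0| + 1) (hpos 0)).1, fun t => ?_⟩
  -- A single solution, on the interval of radius `|t| + 2`, represents the glued function on a
  -- whole neighbourhood of `t`.
  have hS : 0 < |t| + 2 := by positivity
  have hev : (fun s => γ (|s| + 1) s) =ᶠ[𝓝 t] γ (|t| + 2) := by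
    have : ∀ᶠ s in 𝓝 t, |s| < |t| + 1 :=
      continuous_abs.continuousAt.eventually (gt_mem_nhds (lt_add_one |t|))
    filter_upwards [this] with s hs
    exact hagree _ _ (hpos s) (by linarith) (hmem s)
  have h := (hγ _ hS).2 t (abs_lt.1 (by linarith))
  refine (h.congr_of_eventuallyEq hev).congr_deriv ?_
  exact congrArg F hev.eq_of_nhds.symm

/-- A differentiable function which starts nonpositive and satisfies `g' ≤ C g` wherever it is
positive stays nonpositive. -/
lemma nonpos_of_deriv_le_mul {g g' : ℝ → ℝ} {C t₀ t₁ : ℝ} (ht : t₀ ≤ t₁)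
    (hg : ∀ t, HasDerivAt g (g' t) t) (h0 : g t₀ ≤ 0)
    (h : ∀ t, t₀ ≤ t → t ≤ t₁ → 0 < g t → g' t ≤ C * g t) : g t₁ ≤ 0 := by
  -- The rate `C + 1` instead of `C` makes the exponential a strict barrier; afterwards `ε` tends to
  -- zero.
  have key : ∀ ε > 0, g t₁ ≤ ε * Real.exp ((C + 1) * (t₁ - t₀)) := by
    intro ε hε
    have hBd : ∀ x, HasDerivAt (fun t => ε * Real.exp ((C + 1) * (t - t₀)))
        ((C + 1) * (ε * Real.exp ((C + 1) * (x - t₀)))) x := by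
      intro x
      have := ((((hasDerivAt_id x).sub_const t₀).const_mul (C + 1)).exp).const_mul ε
      refine this.congr_deriv ?_
      simp only [id]
      ring
    refine image_le_of_deriv_right_lt_deriv_boundary (f := g) (f' := g')
      (fun x _ => (hg x).continuousAt.continuousWithinAt)
      (fun x _ => (hg x).hasDerivWithinAt) (by simpa using h0.trans hε.le) hBd
      (fun x hx hxe => ?_) ⟨ht, le_rfl⟩
    have hpos : 0 < g x := by rw [hxe]; positivity
    have := h x hx.1 hx.2.le hpos
    rw [← hxe]
    linarith
  have hlim : Tendsto (fun ε : ℝ => ε * Real.exp ((C + 1) * (t₁ - t₀))) (𝓝[>] 0) (𝓝 0) := by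
    have : Continuous fun ε : ℝ => ε * Real.exp ((C + 1) * (t₁ - t₀)) := by fun_prop
    simpa using (this.tendsto 0).mono_left nhdsWithin_le_nhds
  exact ge_of_tendsto hlim (by filter_upwards [self_mem_nhdsWithin] with ε hε using key ε hε)

/-! ### The truncated planar system -/

/-- Truncation of the real line to `[0, R]`. -/
def trunc (R p : ℝ) : ℝ := max 0 (min p R)

lemma trunc_nonneg (R p : ℝ) : 0 ≤ trunc R p := le_max_left _ _

lemma trunc_le {R : ℝ} (hR : 0 ≤ R) (p : ℝ) : trunc R p ≤ R := max_le hR (min_le_right _ _)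

lemma trunc_of_mem {R p : ℝ} (h0 : 0 ≤ p) (h : p ≤ R) : trunc R p = p := by
  rw [trunc, min_eq_left h, max_eq_right h0]

lemma trunc_of_nonpos (R : ℝ) {p : ℝ} (h : p ≤ 0) : trunc R p = 0 :=
  max_eq_left ((min_le_left _ _).trans h)

lemma trunc_of_ge {R p : ℝ} (hR : 0 ≤ R) (h : R ≤ p) : trunc R p = R := by
  rw [trunc, min_eq_right h, max_eq_right hR]

lemma trunc_le_of_le (R : ℝ) {p q : ℝ} (hq : 0 ≤ q) (h : p ≤ q) : trunc R p ≤ q :=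
  max_le hq ((min_le_left _ _).trans h)

lemma lipschitzWith_trunc (R : ℝ) : LipschitzWith 1 (trunc R) :=
  (LipschitzWith.id.min_const R).const_max 0

/-- The vector field of `v' = P`, `P' = κ (c v - G(P))`, with truncated arguments. -/
noncomputable def shootingField (G : ℝ → ℝ) (κ c K R : ℝ) (x : ℝ × ℝ) : ℝ × ℝ :=
  (trunc R x.2, κ * (c * trunc K x.1 - G (trunc R x.2)))

open scoped NNReal in
lemma exists_lipschitzWith_shootingField {G : ℝ → ℝ} {L : ℝ≥0} (hG : LipschitzWith L G)
    (κ c K R : ℝ) : ∃ C, LipschitzWith C (shootingField G κ c K R) :=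
  ⟨_, ((lipschitzWith_trunc R).comp LipschitzWith.prod_snd).prodMk
    ((lipschitzWith_smul κ).comp
      (((lipschitzWith_smul c).comp ((lipschitzWith_trunc K).comp LipschitzWith.prod_fst)).sub
        (hG.comp ((lipschitzWith_trunc R).comp LipschitzWith.prod_snd))))⟩

open scoped NNReal in
lemma exists_norm_shootingField_le {G : ℝ → ℝ} (hG : Continuous G)
    (κ c : ℝ) {K R : ℝ} (hK : 0 ≤ K) (hR : 0 ≤ R) :
    ∃ B : ℝ≥0, ∀ x, ‖shootingField G κ c K R x‖ ≤ B := by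
  obtain ⟨B, hB⟩ := (isCompact_Icc.prod isCompact_Icc : IsCompact (Icc 0 K ×ˢ Icc 0 R))
    |>.exists_bound_of_continuousOn (f := fun x : ℝ × ℝ => (x.2, κ * (c * x.1 - G x.2)))
    (Continuous.continuousOn (by fun_prop))
  refine ⟨B.toNNReal, fun x => (hB (trunc K x.1, trunc R x.2) ?_).trans (Real.le_coe_toNNReal B)⟩
  exact ⟨⟨trunc_nonneg _ _, trunc_le hK _⟩, ⟨trunc_nonneg _ _, trunc_le hR _⟩⟩

/-- A trajectory `(v, P)` of the truncated system. -/
structure IsTrajectory (G : ℝ → ℝ) (κ c K R : ℝ) (v P : ℝ → ℝ) : Prop where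
  hasDerivAt_fst : ∀ t, HasDerivAt v (trunc R (P t)) t
  hasDerivAt_snd : ∀ t, HasDerivAt P (κ * (c * trunc K (v t) - G (trunc R (P t)))) t

/-- A Lipschitz nonlinearity together with constants for which the shooting argument works. -/
structure ShootingData (G : ℝ → ℝ) (L μ κ c K R : ℝ) : Prop where
  L_nonneg : 0 ≤ L
  μ_pos : 0 < μ
  κ_pos : 0 < κ
  c_pos : 0 < c
  K_pos : 0 < K
  R_pos : 0 < R
  lip : ∀ p q, |G p - G q| ≤ L * |p - q|
  le_add : ∀ p, 0 ≤ p → G p ≤ G 0 + μ * p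
  mul_K : c * K = G 0
  le_mul_R : G 0 ≤ μ * R
  lt_R : 8 * κ * μ * K < R

section Trajectory

variable {G : ℝ → ℝ} {L μ κ c K R : ℝ} {v P : ℝ → ℝ}

lemma ShootingData.zero_pos (D : ShootingData G L μ κ c K R) : 0 < G 0 := by
  rw [← D.mul_K]; exact mul_pos D.c_pos D.K_pos

namespace IsTrajectory

lemma monotone_fst (h : IsTrajectory G κ c K R v P) : Monotone v :=
  monotone_of_deriv_nonneg (fun t => (h.hasDerivAt_fst t).differentiableAt)
    fun t => by rw [(h.hasDerivAt_fst t).deriv]; exact trunc_nonneg _ _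

/-- Truncation gives `c * trunc K v ≤ c K = G 0`, so `P' ≤ κ (G 0 - G (trunc R P)) ≤ κ L P` wherever
`P > 0`. -/
lemma snd_nonpos (h : IsTrajectory G κ c K R v P) (D : ShootingData G L μ κ c K R) {s t : ℝ}
    (hst : s ≤ t) (hs : P s ≤ 0) : P t ≤ 0 := by
  refine nonpos_of_deriv_le_mul (C := κ * L) hst h.hasDerivAt_snd hs fun r _ _ hr => ?_
  have h1 : c * trunc K (v r) ≤ G 0 :=
    D.mul_K ▸ mul_le_mul_of_nonneg_left (trunc_le D.K_pos.le _) D.c_pos.le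
  have h2 := (abs_le.1 (D.lip 0 (trunc R (P r)))).2
  rw [zero_sub, abs_neg, abs_of_nonneg (trunc_nonneg _ _)] at h2
  have h3 := mul_le_mul_of_nonneg_left (trunc_le_of_le R hr.le le_rfl) D.L_nonneg
  rw [mul_assoc]
  exact mul_le_mul_of_nonneg_left (by linarith) D.κ_pos.le

/-- Once `v ≥ K` the equation for `P` is autonomous with equilibrium `0`, so `P` decays no faster
than an exponential of rate `κ L`. -/
lemma snd_pos (h : IsTrajectory G κ c K R v P) (D : ShootingData G L μ κ c K R) {s t : ℝ}
    (hst : s ≤ t) (hv : K ≤ v s) (hs : 0 < P s) : 0 < P t := by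
  have hQ : ∀ r, HasDerivAt (fun r => P s * Real.exp (-(κ * L * (r - s))))
      (-(κ * L) * (P s * Real.exp (-(κ * L * (r - s))))) r := by
    intro r
    have := ((((hasDerivAt_id r).sub_const s).const_mul (κ * L)).neg.exp).const_mul (P s)
    refine this.congr_deriv ?_
    simp only [id, Pi.neg_apply]
    ring
  have := nonpos_of_deriv_le_mul (C := 0) hst (fun r => (hQ r).sub (h.hasDerivAt_snd r))
    (by simp) fun r hr _ hpos => by
      set Q := P s * Real.exp (-(κ * L * (r - s))) with hQdef
      have hPQ : P r ≤ Q := (sub_pos.1 hpos).le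
      have hQ0 : 0 ≤ Q := by positivity
      rw [trunc_of_ge D.K_pos.le (hv.trans (h.monotone_fst hr)), D.mul_K, zero_mul]
      have h2 := (abs_le.1 (D.lip 0 (trunc R (P r)))).1
      rw [zero_sub, abs_neg, abs_of_nonneg (trunc_nonneg _ _)] at h2
      have h3 := mul_le_mul_of_nonneg_left (trunc_le_of_le R hQ0 hPQ) D.L_nonneg
      have h4 := mul_le_mul_of_nonneg_left
        (show -(L * Q) ≤ G 0 - G (trunc R (P r)) by linarith) D.κ_pos.le
      linarith
  have h5 : 0 < P s * Real.exp (-(κ * L * (t - s))) := by positivity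
  simp only [Pi.sub_apply] at this
  linarith

/-- `G ≤ 2 μ R` on `[0, R]`, so `P` falls at rate at most `2 κ μ R` and stays above `R / 2` for time
`1 / (4 κ μ)`. Meanwhile `v` gains at least `R / (8 κ μ) > K`. -/
lemma exists_lt_fst_of_le_snd (h : IsTrajectory G κ c K R v P) (D : ShootingData G L μ κ c K R)
    {s : ℝ} (hv : 0 ≤ v s) (hs : R ≤ P s) : ∃ t, s ≤ t ∧ K < v t ∧ 0 < P t := by
  have hκ := D.κ_pos
  have hμ := D.μ_pos
  have hR := D.R_pos
  set τ := 1 / (4 * κ * μ) with hτ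
  have hτ0 : 0 < τ := by positivity
  have hτR : 2 * κ * μ * R * τ = R / 2 := by rw [hτ]; field_simp; norm_num
  have hP : ∀ t, s ≤ t → t ≤ s + τ → R / 2 ≤ P t := by
    intro t hst ht
    have hlin : ∀ r, HasDerivAt (fun r => R - 2 * κ * μ * R * (r - s)) (-(2 * κ * μ * R)) r := by
      intro r
      have := (((hasDerivAt_id r).sub_const s).const_mul (2 * κ * μ * R)).const_sub R
      exact this.congr_deriv (by simp)
    have := nonpos_of_deriv_le_mul (C := 0) hst (fun r => (hlin r).sub (h.hasDerivAt_snd r))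
      (by simpa using hs) fun r _ _ _ => by
        have h1 := D.le_add _ (trunc_nonneg R (P r))
        have h2 := mul_le_mul_of_nonneg_left (trunc_le hR.le (P r)) hμ.le
        have h3 := mul_nonneg D.c_pos.le (trunc_nonneg K (v r))
        have h4 := D.le_mul_R
        have h5 := mul_le_mul_of_nonneg_left
          (show -(2 * μ * R) ≤ c * trunc K (v r) - G (trunc R (P r)) by linarith) hκ.le
        linarith
    have h6 : 2 * κ * μ * R * (t - s) ≤ 2 * κ * μ * R * τ :=
      mul_le_mul_of_nonneg_left (by linarith) (by positivity)
    simp only [Pi.sub_apply] at this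
    linarith
  have hst : s ≤ s + τ := by linarith
  refine ⟨s + τ, hst, ?_, by linarith [hP _ hst le_rfl]⟩
  have hlin : ∀ r, HasDerivAt (fun r => R / 2 * (r - s)) (R / 2) r := by
    intro r
    have := ((hasDerivAt_id r).sub_const s).const_mul (R / 2)
    exact this.congr_deriv (by simp)
  have := nonpos_of_deriv_le_mul (C := 0) hst (fun r => (hlin r).sub (h.hasDerivAt_fst r))
    (by simpa using hv) fun r hr hr' _ => by
      have h1 : R / 2 ≤ trunc R (P r) :=
        (le_min (hP r hr hr') (by linarith)).trans (le_max_right _ _)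
      linarith
  have h2 : K < R / 2 * τ := by
    rw [hτ, mul_one_div, lt_div_iff₀ (by positivity)]
    linarith [D.lt_R]
  simp only [Pi.sub_apply] at this
  linarith

end IsTrajectory

end Trajectory

/-! ### Shooting -/

section Shooting

variable {G : ℝ → ℝ} {L μ κ c K R : ℝ}

lemma ShootingData.lipschitzWith (D : ShootingData G L μ κ c K R) :
    LipschitzWith L.toNNReal G :=
  LipschitzWith.of_dist_le_mul fun p q => by
    rw [Real.dist_eq, Real.dist_eq, Real.coe_toNNReal _ D.L_nonneg]
    exact D.lip p q

/-- A family of trajectories issued from `(0, p)` depending continuously on `p`. -/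
lemma ShootingData.exists_trajectories (D : ShootingData G L μ κ c K R) :
    ∃ v P : ℝ → ℝ → ℝ, (∀ p, IsTrajectory G κ c K R (v p) (P p) ∧ v p 0 = 0 ∧ P p 0 = p) ∧
      ∀ t, 0 ≤ t → Continuous (fun p => v p t) ∧ Continuous (fun p => P p t) := by
  obtain ⟨C, hC⟩ := exists_lipschitzWith_shootingField D.lipschitzWith κ c K R
  obtain ⟨B, hB⟩ := exists_norm_shootingField_le D.lipschitzWith.continuous κ c D.K_pos.le
    D.R_pos.le
  choose α h0 hα using fun p : ℝ => exists_global_trajectory hC hB ((0 : ℝ), p)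
  have hcont : ∀ t, 0 ≤ t → Continuous fun p => α p t := by
    intro t ht
    refine LipschitzWith.continuous (K := (Real.exp (C * t)).toNNReal) ?_
    refine LipschitzWith.of_dist_le_mul fun p q => ?_
    have := dist_le_of_trajectories_ODE (v := fun _ => shootingField G κ c K R) (a := 0) (b := t)
      (δ := dist p q) (fun _ => hC)
      (fun r _ => (hα p r).continuousAt.continuousWithinAt)
      (fun r _ => (hα p r).hasDerivWithinAt)
      (fun r _ => (hα q r).continuousAt.continuousWithinAt)
      (fun r _ => (hα q r).hasDerivWithinAt)
      (by rw [h0, h0, Prod.dist_eq]; simp) t ⟨ht, le_rfl⟩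
    rw [sub_zero] at this
    rwa [Real.coe_toNNReal _ (Real.exp_pos _).le, mul_comm]
  refine ⟨fun p t => (α p t).1, fun p t => (α p t).2, fun p => ⟨⟨fun t => ?_, fun t => ?_⟩,
    by simp [h0], by simp [h0]⟩, fun t ht => ⟨(hcont t ht).fst, (hcont t ht).snd⟩⟩
  · exact hasFDerivAt_fst.comp_hasDerivAt t (hα p t)
  · exact hasFDerivAt_snd.comp_hasDerivAt t (hα p t)

/-- For a suitable initial slope the trajectory stays in the region where nothing is truncated. -/
theorem ShootingData.exists_bounded_trajectory (D : ShootingData G L μ κ c K R) :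
    ∃ v P : ℝ → ℝ, IsTrajectory G κ c K R v P ∧ v 0 = 0 ∧
      ∀ t, 0 ≤ t → (0 ≤ v t ∧ v t ≤ K) ∧ 0 ≤ P t ∧ P t ≤ R := by
  obtain ⟨v, P, h, hcont⟩ := D.exists_trajectories
  -- `A` collects the slopes that undershoot, `B` those that overshoot. A trajectory cannot do both,
  -- since each of the two events is irreversible.
  set A : Set ℝ := ⋃ t ∈ Ici (0 : ℝ), {p | P p t < 0} with hA
  set B : Set ℝ := ⋃ t ∈ Ici (0 : ℝ), ({p | K < v p t} ∩ {p | 0 < P p t}) with hB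
  have hAo : IsOpen A := isOpen_biUnion fun t ht => isOpen_lt (hcont t ht).2 continuous_const
  have hBo : IsOpen B := isOpen_biUnion fun t ht =>
    (isOpen_lt continuous_const (hcont t ht).1).inter (isOpen_lt continuous_const (hcont t ht).2)
  have hAB : ∀ p, p ∈ A → p ∈ B → False := by
    intro p hpA hpB
    simp only [hA, hB, mem_iUnion, mem_Ici] at hpA hpB
    obtain ⟨s, hs0, hs⟩ := hpA
    obtain ⟨t, ht0, htv, htP⟩ := hpB
    replace hs : P p s < 0 := hs
    replace htv : K < v p t := htv
    replace htP : 0 < P p t := htP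
    rcases le_total s t with hst | hst
    · exact htP.not_ge ((h p).1.snd_nonpos D hst hs.le)
    · exact hs.not_gt ((h p).1.snd_pos D hst htv.le htP)
  have h0A : (0 : ℝ) ∈ A := by
    -- From the origin, `P` starts with derivative `-κ * G 0 < 0`.
    have hd := (h 0).1.hasDerivAt_snd 0
    rw [(h 0).2.1, (h 0).2.2, trunc_of_nonpos _ le_rfl, trunc_of_nonpos _ le_rfl] at hd
    have hneg : κ * (c * 0 - G 0) < 0 :=
      mul_neg_of_pos_of_neg D.κ_pos (by linarith [D.zero_pos])
    obtain ⟨t, hlt, ht⟩ := ((hd.hasDerivWithinAt (s := Ici 0)).liminf_right_slope_le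
      hneg |>.and_eventually self_mem_nhdsWithin).exists
    simp only [hA, mem_iUnion, mem_Ici]
    refine ⟨t, le_of_lt ht, ?_⟩
    rw [slope_def_field, (h 0).2.2, sub_zero, sub_zero, div_neg_iff] at hlt
    rcases hlt with hlt | hlt
    · exact absurd hlt.2 (not_lt.2 (le_of_lt ht))
    · exact hlt.1
  have hRB : R ∈ B := by
    obtain ⟨t, ht, h1, h2⟩ := (h R).1.exists_lt_fst_of_le_snd D (s := 0)
      (h R).2.1.ge (h R).2.2.ge
    simp only [hB, mem_iUnion, mem_Ici]
    exact ⟨t, ht, h1, h2⟩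
  obtain ⟨p, hpA, hpB⟩ : ∃ p, p ∉ A ∧ p ∉ B := by
    by_contra! hcov
    obtain ⟨p, _, hpA, hpB⟩ := isPreconnected_univ A B hAo hBo
      (fun p _ => or_iff_not_imp_left.2 (hcov p)) ⟨0, mem_univ _, h0A⟩ ⟨R, mem_univ _, hRB⟩
    exact hAB p hpA hpB
  obtain ⟨htraj, hv0, -⟩ := h p
  have hP0 : ∀ t, 0 ≤ t → 0 ≤ P p t := by
    intro t ht
    by_contra! hlt
    exact hpA (mem_biUnion (show t ∈ Ici (0 : ℝ) from ht) hlt)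
  have hvP : ∀ t, 0 ≤ t → K < v p t → P p t ≤ 0 := by
    intro t ht hlt
    by_contra! hpos
    exact hpB (mem_biUnion (show t ∈ Ici (0 : ℝ) from ht) ⟨hlt, hpos⟩)
  have hvnn : ∀ t, 0 ≤ t → 0 ≤ v p t := fun t ht => hv0 ▸ htraj.monotone_fst ht
  refine ⟨v p, P p, htraj, hv0, fun t ht => ⟨⟨hvnn t ht, ?_⟩, hP0 t ht, ?_⟩⟩
  -- Above `K` the slope is nonpositive, so its truncation vanishes and `v` cannot grow.
  · have := nonpos_of_deriv_le_mul (C := 0) ht (fun r => (htraj.hasDerivAt_fst r).sub_const K)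
      (by rw [hv0]; linarith [D.K_pos]) fun r hr _ hpos => by
        rw [trunc_of_nonpos R (hvP r hr (by linarith)), zero_mul]
    linarith
  · by_contra! hlt
    obtain ⟨s, hs, h1, h2⟩ := htraj.exists_lt_fst_of_le_snd D (hvnn t ht) hlt.le
    exact h2.not_ge (hvP s (ht.trans hs) h1)

/-- Existence of a bounded nondecreasing classical solution on the half-line. -/
theorem ShootingData.exists_classical_solution (D : ShootingData G L μ κ c K R) :
    ∃ V : ℝ → ℝ, ContDiff ℝ 2 V ∧ V 0 = 0 ∧ MonotoneOn V (Ici 0) ∧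
      (∀ x, 0 ≤ x → 0 ≤ V x ∧ V x ≤ K) ∧
      ∀ x, 0 ≤ x → deriv (deriv V) x = κ * (c * V x - G (deriv V x)) := by
  obtain ⟨v, P, h, hv0, hbd⟩ := D.exists_bounded_trajectory
  have hvc : Continuous v := continuous_iff_continuousAt.2 fun t =>
    (h.hasDerivAt_fst t).continuousAt
  have hPc : Continuous P := continuous_iff_continuousAt.2 fun t =>
    (h.hasDerivAt_snd t).continuousAt
  have hGc := D.lipschitzWith.continuous
  -- The trajectory is free of truncation only for nonnegative times. Freezing the second derivative
  -- at its value at `0` on the negative axis and integrating twice gives a `C²` function on the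
  -- whole line.
  set w : ℝ → ℝ := fun x => κ * (c * v (max x 0) - G (P (max x 0))) with hw
  have hwc : Continuous w := by fun_prop
  set Q : ℝ → ℝ := fun x => P 0 + ∫ t in (0 : ℝ)..x, w t with hQ
  have hQd : ∀ x, HasDerivAt Q (w x) x := fun x =>
    ((hwc.integral_hasStrictDerivAt 0 x).hasDerivAt).const_add _
  have hQc : Continuous Q := continuous_iff_continuousAt.2 fun t => (hQd t).continuousAt
  set V : ℝ → ℝ := fun x => ∫ t in (0 : ℝ)..x, Q t with hV
  have hVd : ∀ x, HasDerivAt V (Q x) x := fun x => (hQc.integral_hasStrictDerivAt 0 x).hasDerivAt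
  have hQP : ∀ x, 0 ≤ x → Q x = P x := by
    intro x hx
    have : ∫ t in (0 : ℝ)..x, w t = P x - P 0 := by
      refine intervalIntegral.integral_eq_sub_of_hasDerivAt (fun t ht => ?_)
        (hwc.intervalIntegrable _ _)
      rw [uIcc_of_le hx] at ht
      obtain ⟨⟨h1, h2⟩, h3, h4⟩ := hbd t ht.1
      have := h.hasDerivAt_snd t
      rw [trunc_of_mem h1 h2, trunc_of_mem h3 h4] at this
      simpa only [hw, max_eq_left ht.1] using this
    simp only [hQ, this, add_sub_cancel]
  have hVv : ∀ x, 0 ≤ x → V x = v x := by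
    intro x hx
    have : ∫ t in (0 : ℝ)..x, Q t = v x - v 0 := by
      refine intervalIntegral.integral_eq_sub_of_hasDerivAt (fun t ht => ?_)
        (hQc.intervalIntegrable _ _)
      rw [uIcc_of_le hx] at ht
      obtain ⟨-, h3, h4⟩ := hbd t ht.1
      have := h.hasDerivAt_fst t
      rwa [trunc_of_mem h3 h4, ← hQP t ht.1] at this
    simp only [hV, this, hv0, sub_zero]
  have hdV : deriv V = Q := funext fun x => (hVd x).deriv
  have hdQ : deriv Q = w := funext fun x => (hQd x).deriv
  refine ⟨V, ?_, by simp [hV], ?_, ?_, ?_⟩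
  · have hQ1 : ContDiff ℝ 1 Q :=
      contDiff_one_iff_deriv.2 ⟨fun x => (hQd x).differentiableAt, hdQ ▸ hwc⟩
    rw [show (2 : WithTop ℕ∞) = 1 + 1 by norm_num, contDiff_succ_iff_deriv]
    exact ⟨fun x => (hVd x).differentiableAt, by simp, hdV ▸ hQ1⟩
  · intro x hx y hy hxy
    rw [hVv x hx, hVv y hy]
    exact h.monotone_fst hxy
  · intro x hx
    rw [hVv x hx]
    exact (hbd x hx).1
  · intro x hx
    rw [hdV, hdQ, hVv x hx, hQP x hx]
    simp only [hw, max_eq_left hx]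

end Shooting

/-! ### ### The classical solution and its consequences -/

/-- A bounded nondecreasing classical solution on `[0, ∞)` of
`(σ² / 2) V'' + f(V') - c V = 0`, `V(0) = 0`, extended to a `C²` function on the line. -/
structure IsClassicalSolution (μ σ c a lam : ℝ) (V : ℝ → ℝ) : Prop where
  contDiff : ContDiff ℝ 2 V
  zero : V 0 = 0
  classL : ClassL V
  eq_zero : ∀ x, 0 < x →
    1 / 2 * σ ^ 2 * deriv (deriv V) x + f μ a lam (deriv V x) - c * V x = 0

section Main

variable {μ σ c a lam : ℝ}

theorem exists_isClassicalSolution (hσ : σ ≠ 0) (hc : 0 < c) (hlam : 0 < lam)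
    (ha : max 1 (2 * μ) < a) (hμ : 0 < μ) : ∃ V, IsClassicalSolution μ σ c a lam V := by
  have ha0 : 0 < a := zero_lt_one.trans ((le_max_left _ _).trans_lt ha)
  have haμ : μ ≤ a := by linarith [(le_max_right _ _).trans_lt ha]
  have hf0 : 0 < f μ a lam 0 := hμ.trans (lt_f ha hlam zero_le_one)
  have hσ2 : 0 < σ ^ 2 := by positivity
  set κ := 2 / σ ^ 2 with hκ
  set K := f μ a lam 0 / c with hK
  have hK0 : 0 < K := div_pos hf0 hc
  have hκ0 : 0 < κ := by positivity
  have hR0 : 0 < f μ a lam 0 / μ := div_pos hf0 hμ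
  have hR1 : 0 < 8 * κ * μ * K := by positivity
  -- The slope bound is the sum of the two lower bounds required of `R`; both summands are positive,
  -- so the strict one holds too.
  have D : ShootingData (f μ a lam) a μ κ c K (f μ a lam 0 / μ + 8 * κ * μ * K) :=
    { L_nonneg := ha0.le
      μ_pos := hμ
      κ_pos := hκ0
      c_pos := hc
      K_pos := hK0
      R_pos := by linarith
      lip := abs_f_sub_le hμ haμ hlam
      le_add := fun p hp => f_le_add_mul μ ha0 hlam hp
      mul_K := mul_div_cancel₀ _ hc.ne'
      le_mul_R := by
        rw [mul_add, mul_div_cancel₀ _ hμ.ne']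
        linarith [mul_pos hμ hR1]
      lt_R := by linarith }
  obtain ⟨V, hV, h0, hmono, hbd, hode⟩ := D.exists_classical_solution
  refine ⟨V, hV, h0, ⟨hmono, K, fun x hx => abs_le.2 ⟨by linarith [hbd x hx], (hbd x hx).2⟩⟩,
    fun x hx => ?_⟩
  rw [hode x hx.le, hκ]
  field_simp
  ring

lemma ClassL.sub_le {u v : ℝ → ℝ} (hu : ClassL u) (hv : ClassL v) :
    ∃ C, ∀ x, 0 ≤ x → u x - v x ≤ C := by
  obtain ⟨-, C, hC⟩ := hu
  obtain ⟨-, C', hC'⟩ := hv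
  exact ⟨C + C', fun x hx => by
    linarith [(abs_le.1 (hC x hx)).2, (abs_le.1 (hC' x hx)).1]⟩

lemma ClassL.congr {u v : ℝ → ℝ} (hv : ClassL v) (h : EqOn u v (Ici 0)) : ClassL u :=
  ⟨hv.1.congr h.symm, hv.2.imp fun _ hC x hx => by rw [h hx]; exact hC x hx⟩

namespace IsClassicalSolution

variable {V : ℝ → ℝ}

lemma subsolution_le (hV : IsClassicalSolution μ σ c a lam V) (hμ : 0 < μ) (ha : μ ≤ a)
    (hlam : 0 < lam) (hc : 0 < c) {u : ℝ → ℝ} (hu : IsViscositySubsolution μ σ c a lam u)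
    (huL : ClassL u) {x : ℝ} (hx : 0 ≤ x) : u x ≤ V x := by
  obtain ⟨C, hC⟩ := huL.sub_le hV.classL
  exact hu.le_of_contDiff hμ ha hlam hc hC hV.contDiff hV.zero
    (fun y hy => (hV.eq_zero y hy).le) hx

lemma le_supersolution (hV : IsClassicalSolution μ σ c a lam V) (hμ : 0 < μ) (ha : μ ≤ a)
    (hlam : 0 < lam) (hc : 0 < c) {u : ℝ → ℝ} (hu : IsViscositySupersolution μ σ c a lam u)
    (huL : ClassL u) {x : ℝ} (hx : 0 ≤ x) : V x ≤ u x := by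
  obtain ⟨C, hC⟩ := hV.classL.sub_le huL
  exact hu.ge_of_contDiff hμ ha hlam hc hC hV.contDiff hV.zero
    (fun y hy => (hV.eq_zero y hy).ge) hx

lemma isViscositySolution_of_eqOn (hV : IsClassicalSolution μ σ c a lam V) {u : ℝ → ℝ}
    (huV : EqOn u V (Ici 0)) : IsViscositySolution μ σ c a lam u :=
  ⟨hV.contDiff.continuous.continuousOn.congr huV,
    isViscositySubsolution_of_contDiff hV.contDiff huV hV.zero fun x hx => (hV.eq_zero x hx).ge,
    isViscositySupersolution_of_contDiff hV.contDiff huV hV.zero fun x hx => (hV.eq_zero x hx).le⟩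

end IsClassicalSolution

lemma classL_psiLower : ClassL psiLower := by
  refine ⟨fun x _ y _ hxy => ?_, 1, fun x hx => ?_⟩
  · simp only [psiLower]
    gcongr
  · have h1 := Real.exp_pos (-x)
    have h2 : Real.exp (-x) ≤ 1 := Real.exp_le_one_iff.2 (by linarith)
    rw [psiLower, abs_le]
    constructor <;> linarith

lemma classL_psiUpper {A M b : ℝ} (hA : 0 < A) (hM : 0 < M) (hb : 0 < b) :
    ClassL (psiUpper A M b) := by
  refine ⟨fun x _ y _ hxy => ?_, A / M, fun x hx => ?_⟩
  · simp only [psiUpper]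
    gcongr
  · rw [abs_of_nonneg (psiUpper_nonneg hA hM hb hx)]
    exact psiUpper_le hA hM x

lemma isViscositySubsolution_psiLower (hlam : 0 < lam) (ha : max 1 (2 * μ) < a)
    (hμ : max c (σ ^ 2 / 2) < μ) : IsViscositySubsolution μ σ c a lam psiLower :=
  isViscositySubsolution_of_contDiff contDiff_psiLower (eqOn_refl _ _) (by simp [psiLower])
    fun _ hx => psiLower_classical_subsolution hlam ha hμ hx.le

/-- The classical solution is the largest element of the Perron family. -/
lemma IsClassicalSolution.eqOn_perronSup {V : ℝ → ℝ} (hV : IsClassicalSolution μ σ c a lam V)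
    (hσ : σ ≠ 0) (hc : 0 < c) (hlam : 0 < lam) (ha : max 1 (2 * μ) < a)
    (hμ : max c (σ ^ 2 / 2) < μ) {H A M b : ℝ} (hB : BarrierConstants μ σ c a lam H A M b) :
    EqOn (perronSup μ σ c a lam A M b) V (Ici 0) := by
  intro x hx
  have hμ0 : 0 < μ := hc.trans ((le_max_left _ _).trans_lt hμ)
  have haμ : μ ≤ a := by linarith [(le_max_right _ _).trans_lt ha]
  have hVvisc := hV.isViscositySolution_of_eqOn (eqOn_refl V _)
  have hmem : V ∈ perronFamily μ σ c a lam A M b :=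
    ⟨hVvisc.1, fun y hy =>
      ⟨hV.subsolution_le hμ0 haμ hlam hc (isViscositySubsolution_psiLower hlam ha hμ)
        classL_psiLower hy,
      hV.le_supersolution hμ0 haμ hlam hc (psiUpper_isViscositySupersolution hσ hc hlam ha hμ0 hB)
        (classL_psiUpper hB.A_pos hB.M_pos hB.b_pos) hy⟩, hV.classL, hVvisc.2.1⟩
  refine IsGreatest.csSup_eq ⟨mem_image_of_mem (fun u : ℝ → ℝ => u x) hmem, ?_⟩
  rintro _ ⟨u, hu, rfl⟩
  exact hV.subsolution_le hμ0 haμ hlam hc hu.2.2.2 hu.2.2.1 hx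

lemma tendsto_of_eqOn {u V : ℝ → ℝ} (hV : Continuous V) (h : EqOn u V (Ici 0)) {x : ℝ} :
    Tendsto u (𝓝[Ioi 0] x) (𝓝 (V x)) := by
  refine ((hV.tendsto x).mono_left nhdsWithin_le_nhds).congr' ?_
  filter_upwards [self_mem_nhdsWithin] with y hy using (h (Ioi_subset_Ici_self hy)).symm

end Main

end Dividend

theorem mainTheorem6 (μ σ c a lam : ℝ) (hσ : σ ≠ 0) (hc : 0 < c) (hlam : 0 < lam)
    (ha : max 1 (2 * μ) < a) (hμ : max c (σ ^ 2 / 2) < μ) :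
    (∀ vUp vLow : ℝ → ℝ,
      Dividend.IsViscositySupersolution μ σ c a lam vUp → Dividend.ClassL vUp →
      Dividend.IsViscositySubsolution μ σ c a lam vLow → Dividend.ClassL vLow →
        ∀ x : ℝ, 0 ≤ x → vLow x ≤ vUp x) ∧
    (∀ H A M b : ℝ, Dividend.BarrierConstants μ σ c a lam H A M b →
      (∀ x : ℝ, 0 ≤ x →
        Dividend.uscEnvelope (Dividend.perronSup μ σ c a lam A M b) x =
          Dividend.lscEnvelope (Dividend.perronSup μ σ c a lam A M b) x ∧
        Dividend.lscEnvelope (Dividend.perronSup μ σ c a lam A M b) x =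
          Dividend.perronSup μ σ c a lam A M b x) ∧
      Dividend.IsViscositySolution μ σ c a lam (Dividend.perronSup μ σ c a lam A M b) ∧
      Dividend.ClassL (Dividend.perronSup μ σ c a lam A M b) ∧
      ∀ w : ℝ → ℝ, Dividend.IsViscositySolution μ σ c a lam w → Dividend.ClassL w →
        ∀ x : ℝ, 0 ≤ x → w x = Dividend.perronSup μ σ c a lam A M b x) := by
  have hμ0 : 0 < μ := hc.trans ((le_max_left _ _).trans_lt hμ)
  have haμ : μ ≤ a := by linarith [(le_max_right _ _).trans_lt ha]
  obtain ⟨V, hV⟩ := Dividend.exists_isClassicalSolution hσ hc hlam ha hμ0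
  refine ⟨fun vUp vLow hUp hUpL hLow hLowL x hx =>
    (hV.subsolution_le hμ0 haμ hlam hc hLow hLowL hx).trans
      (hV.le_supersolution hμ0 haμ hlam hc hUp hUpL hx), fun H A M b hB => ?_⟩
  have hEq := hV.eqOn_perronSup hσ hc hlam ha hμ hB
  refine ⟨fun x hx => ?_, hV.isViscositySolution_of_eqOn hEq, hV.classL.congr hEq,
    fun w hw hwL x hx => ?_⟩
  · have ht := Dividend.tendsto_of_eqOn (x := x) hV.contDiff.continuous hEq
    -- At `x = 0` the envelopes use only points to the right, and `0` lies in the closure of `Ioi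
    -- 0`.
    have : (𝓝[Ioi 0] x).NeBot := by
      rw [← mem_closure_iff_nhdsWithin_neBot, closure_Ioi]
      exact hx
    rw [Dividend.uscEnvelope, Dividend.lscEnvelope, ht.limsup_eq, ht.liminf_eq, hEq hx]
    exact ⟨rfl, rfl⟩
  · rw [hEq hx]
    exact le_antisymm (hV.subsolution_le hμ0 haμ hlam hc hw.2.1 hwL hx)
      (hV.le_supersolution hμ0 haμ hlam hc hw.2.2 hwL hx)
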